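/- **Conventions.** Fix a universal machine $\mathbf U$: a partial recursive function $\mathbf U(\langle x,w\rangle)$ of a datum $x\in\{0,1\}^*$ and a program $w\in\{0,1\}^*$ such that, for every partial recursive $\varphi(\langle x,w\rangle)$, there are a constant $c_\varphi$ and a map $w\mapsto\tau(w)$ with $l(\tau(w))\le l(w)+c_\varphi$ and $\mathbf U(\langle x,\tau(w)\rangle)=\varphi(\langle x,w\rangle)$ for all $x,w$. The plain conditional complexity $C(y\mid x)$ is the length of a shortest $w$ with $\mathbf U(\langle x,w\rangle)=y$. Numbers and tuples of numbers are encoded as binary strings by a fixed recursive pairing. A *simple TVG* $\mathrm G_t=(\mathrm V,\mathscr E,\mathrm T)$ consists of finite sets $\mathrm V,\mathrm T\subset\mathbb N$ (vertices and time instants) and a set $\mathscr E\subseteq\mathbb E_c(\mathrm G_t)$ of composite edges, where $\mathbb V(\mathrm G_t)=\mathrm V\times\mathrm T$ is the set of composite vertices and $\mathbb E_c(\mathrm G_t)$ is the set of all $\binom{|\mathbb V(\mathrm G_t)|}{2}$ unordered pairs of distinct composite vertices. Degrees, paths and distances are those of the graph $(\mathbb V(\mathrm G_t),\mathscr E)$;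 the composite diameter is the maximum distance between two composite vertices. A family $F$ of simple TVGs is *recursively labeled* if there are one sequence $e_1,e_2,\dots$ of pairs of composite vertices and two programs $\mathrm p_1',\mathrm p_2'$ such that, for every $\mathrm G_t\in F$, the first $|\mathbb E_c(\mathrm G_t)|$ terms of the sequence, as unordered pairs, enumerate $\mathbb E_c(\mathrm G_t)$ without repetition and, for $1\le j\le|\mathbb E_c(\mathrm G_t)|$, $\mathbf U(\langle\langle \mathbf a,\mathbf b\rangle,\mathrm p_1'\rangle)=(j)_2$ whenever $\{\mathbf a,\mathbf b\}$ is the unordered pair $e_j$, and $\mathbf U(\langle j,\mathrm p_2'\rangle)=\langle e_j\rangle$; moreover, $\mathbf U(\langle\langle \mathbf a,\mathbf b\rangle,\mathrm p_1'\rangle)=0$ if $\mathbf a$ or $\mathbf b$ is a composite vertex of no member of $F$, and $\mathbf U(\langle j,\mathrm p_2'\rangle)=\langle0\rangle$ if $1\le j\le|\mathbb E_c(\mathrm G_t)|$ holds for no $\mathrm G_t\in F$. For $\delta:\mathbb N\to\mathbb N$, a member $\mathrm G_t$ of $F$ is *$\delta(|\mathbb V(\mathrm G_t)|)$-C-random*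 if $$C\big(\langle\mathscr E(\mathrm G_t)\rangle\,\big|\,|\mathbb V(\mathrm G_t)|\big)\ \ge\ \binom{|\mathbb V(\mathrm G_t)|}{2}-\delta(|\mathbb V(\mathrm G_t)|),$$ where $\langle\mathscr E(\mathrm G_t)\rangle=\langle\langle e_1,z_1\rangle,\dots,\langle e_n,z_n\rangle\rangle$, $n=|\mathbb E_c(\mathrm G_t)|$, and $z_i=1$ if the unordered pair $e_i$ belongs to $\mathscr E(\mathrm G_t)$, $z_i=0$ otherwise. **Corollary 5.1.** Let $F$ be a recursively labeled infinite family of simple TVGs and let $\delta:\mathbb N\to\mathbb N$ satisfy $\delta(n)=\mathbf O(\log_2 n)$. Suppose that every $\mathrm G_t\in F$ is $\delta(|\mathbb V(\mathrm G_t)|)$-C-random. Then there are a constant $c$, a function $\varepsilon:\mathbb N\to\mathbb R$ with $\varepsilon(n)=\mathbf o(n)$, and an $n_0$ such that the following hold for every $\mathrm G_t\in F$ with $N:=|\mathbb V(\mathrm G_t)|\ge n_0$: 1. every composite vertex $\mathbf v\in\mathbb V(\mathrm G_t)$ has a degree $\mathbf d(\mathbf v)$ with $\left|\mathbf d(\mathbf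 v)-\frac{N-1}{2}\right|\le c\sqrt{N\log_2 N}$; 2. for every pair of distinct composite vertices $\mathbf u,\mathbf v\in\mathbb V(\mathrm G_t)$, the maximum number $m$ of paths of length $2$ between $\mathbf u$ and $\mathbf v$ that pairwise share no vertex other than $\mathbf u$ and $\mathbf v$ satisfies $\left|m-\frac N4\right|\le\varepsilon(N)$; 3. the composite diameter of $\mathrm G_t$ is $2$. -/

import Mathlib

open Filter Asymptotics Topology

/-! ### Plain algorithmic complexity -/

/-- A (partial) machine on binary strings: `U x w` is the output, if there is one, on the input
pair consisting of the datum `x` and the program `w`. -/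
abbrev Machine : Type := List Bool → List Bool →. List Bool

/-- A universal machine: it is partial recursive, and every program `w` of any other partial
recursive machine `φ` can be translated into a program `τ w` of `U` that computes the same partial
function of the datum, at the price of a constant number of additional bits. -/
structure IsUniversal (U : Machine) : Prop where
  partrec : Partrec₂ U
  simulates : ∀ φ : Machine, Partrec₂ φ → ∃ (τ : List Bool → List Bool) (c : ℕ),
    (∀ w, (τ w).length ≤ w.length + c) ∧ ∀ x w, U x (τ w) = φ x w

/-- Universal machines exist. -/
theorem exists_isUniversal : ∃ U : Machine, IsUniversal U := by
  have hidx : Primrec fun w : List Bool => w.findIdx (fun b => !b) :=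
    Primrec.list_findIdx Primrec.id (Primrec.not.comp Primrec.snd).to₂
  have hdrop : Primrec fun w : List Bool => w.drop (w.findIdx (fun b => !b) + 1) :=
    Primrec.list_drop.comp (Primrec.succ.comp hidx) Primrec.id
  refine ⟨fun x w => (Nat.Partrec.Code.eval (Denumerable.ofNat Nat.Partrec.Code
      (w.findIdx (fun b => !b)))
      (Encodable.encode (x, w.drop (w.findIdx (fun b => !b) + 1)))).bind
      fun n => (Encodable.decode (α := List Bool) n : Part (List Bool)), ?_, ?_⟩
  · refine Partrec.bind (Nat.Partrec.Code.eval_part.comp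
      ((Computable.ofNat _).comp (hidx.to_comp.comp Computable.snd))
      (Computable.encode.comp (Computable.pair Computable.fst
        (hdrop.to_comp.comp Computable.snd)))) ?_
    exact (Computable.ofOption (Computable.decode.comp Computable.snd))
  · intro φ hφ
    obtain ⟨c, hc⟩ := Nat.Partrec.Code.exists_code.1 hφ
    refine ⟨fun w => List.replicate (Encodable.encode c) true ++ false :: w,
      Encodable.encode c + 1, fun w => by simp; omega, fun x w => ?_⟩
    have h1 : ∀ n : ℕ, (List.replicate n true ++ false :: w).findIdx (fun b => !b) = n := by
      intro n
      induction n with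
      | zero => simp [List.findIdx_cons]
      | succ n ih => simp [List.replicate_succ, List.findIdx_cons, ih]
    have h2 : ∀ n : ℕ, (List.replicate n true ++ false :: w).drop (n + 1) = w := by
      intro n
      induction n with
      | zero => simp
      | succ n ih => simpa [List.replicate_succ] using ih
    simp only [h1, h2, Denumerable.ofNat_encode, hc]
    simp [Encodable.encodek, Part.bind_map, Part.bind_some_right]

/-- The conditional plain algorithmic complexity `C(y | x)` with respect to `U`: the length of a
shortest program with which `U` outputs `y` on the datum `x`. -/
noncomputable def plainComplexity (U : Machine) (y x : List Bool) : ℕ :=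
  sInf {l : ℕ | ∃ w : List Bool, w.length = l ∧ y ∈ U x w}

/-- The binary string that represents a finite object. Natural numbers are written in binary;
pairs are first turned into natural numbers by the recursive bijective pairing function
`Nat.pair`, and finite lists by iterating it. -/
def binaryCode {α : Type*} [Encodable α] (a : α) : List Bool :=
  Nat.bits (Encodable.encode a)

/-! ### Simple time-varying graphs -/

/-- A composite vertex `(v, t)`: a vertex label together with a time-instant label. -/
abbrev CompositeVertex : Type := ℕ × ℕ

/-- A simple (undirected, loopless) time-varying graph `(V, ℰ, T)`: a finite set `V` of vertices,
a finite set `T` of time instants and a set `ℰ` of unordered pairs of distinct elements of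
`V × T`. -/
structure SimpleTVG where
  V : Finset ℕ
  T : Finset ℕ
  E : Finset (Sym2 CompositeVertex)
  E_subset : E ⊆ (V ×ˢ T).offDiag.image fun p => s(p.1, p.2)

namespace SimpleTVG

/-- The set `𝕍(G) = V × T` of composite vertices. -/
def compositeVertices (G : SimpleTVG) : Finset CompositeVertex := G.V ×ˢ G.T

/-- The number `|𝕍(G)|` of composite vertices. -/
def order (G : SimpleTVG) : ℕ := G.compositeVertices.card

/-- The set `𝔼_c(G)` of all possible composite edges. -/
def possibleEdges (G : SimpleTVG) : Finset (Sym2 CompositeVertex) :=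
  G.compositeVertices.offDiag.image fun p => s(p.1, p.2)

theorem card_possibleEdges (G : SimpleTVG) : G.possibleEdges.card = G.order.choose 2 :=
  Sym2.card_image_offDiag G.compositeVertices

/-- The composite vertices and composite edges as a graph: the classical graph isomorphic to the
time-varying graph. -/
def graph (G : SimpleTVG) : SimpleGraph {a : CompositeVertex // a ∈ G.compositeVertices} where
  Adj u v := s(u.1, v.1) ∈ G.E
  symm := ⟨fun u v h => by rwa [Sym2.eq_swap]⟩
  loopless := ⟨fun u h => by
    obtain ⟨p, hp, he⟩ := Finset.mem_image.1 (G.E_subset h)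
    have hne := (Finset.mem_offDiag.1 hp).2.2
    rcases Sym2.eq_iff.1 he with ⟨h1, h2⟩ | ⟨h1, h2⟩
    · exact hne (h1.trans h2.symm)
    · exact hne (h1.trans h2.symm)⟩

/-- The string `⟨⟨e₁, z₁⟩, …, ⟨eₙ, zₙ⟩⟩` of the composite edge set, where `n = |𝔼_c(G)|` and
`zᵢ = 1` if and only if `eᵢ` is a composite edge of `G`. -/
def edgeString (e : ℕ → CompositeVertex × CompositeVertex) (G : SimpleTVG) : List Bool :=
  binaryCode ((List.range G.possibleEdges.card).map fun i =>
    (e (i + 1), decide (s((e (i + 1)).1, (e (i + 1)).2) ∈ G.E)))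

/-- `G` is `δ(|𝕍(G)|)`-C-random, the composite edges being ordered by `e`:
`C(ℰ(G) | |𝕍(G)|) ≥ binom(|𝕍(G)|, 2) - δ(|𝕍(G)|)`. -/
def IsCRandom (U : Machine) (e : ℕ → CompositeVertex × CompositeVertex) (δ : ℕ → ℕ)
    (G : SimpleTVG) : Prop :=
  (G.order.choose 2 : ℝ) - (δ G.order : ℝ)
    ≤ (plainComplexity U (G.edgeString e) (binaryCode G.order) : ℝ)

end SimpleTVG

/-- The family `F` is recursively labeled, with the ordering `e 1, e 2, …` of the possible
composite edges: for every member `G` the first `|𝔼_c(G)|` terms of `e` list `𝔼_c(G)` without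
repetition, and there are two programs, the same for all members, one of which computes the index
of a composite edge from its end points, and the other the composite edge from its index. The two
programs signal by the values `0` and `⟨0⟩` that a composite vertex, or an index, is not one of the
family's. (The code of `⟨0⟩` is not that of any possible composite edge.) -/
def IsRecursivelyLabeled (U : Machine) (F : Set SimpleTVG)
    (e : ℕ → CompositeVertex × CompositeVertex) : Prop :=
  (∀ G ∈ F, Set.BijOn (fun j => s((e j).1, (e j).2)) (Set.Icc 1 G.possibleEdges.card)
    (G.possibleEdges : Set (Sym2 CompositeVertex))) ∧
  ∃ p₁ p₂ : List Bool,
    (∀ G ∈ F, ∀ a b : CompositeVertex, ∀ j ∈ Set.Icc 1 G.possibleEdges.card,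
      s(a, b) = s((e j).1, (e j).2) → binaryCode j ∈ U (binaryCode (a, b)) p₁) ∧
    (∀ a b : CompositeVertex,
      ((∀ G ∈ F, a ∉ G.compositeVertices) ∨ (∀ G ∈ F, b ∉ G.compositeVertices)) →
      binaryCode (0 : ℕ) ∈ U (binaryCode (a, b)) p₁) ∧
    (∀ G ∈ F, ∀ j ∈ Set.Icc 1 G.possibleEdges.card,
      binaryCode (e j) ∈ U (binaryCode j) p₂) ∧
    (∀ j : ℕ, (∀ G ∈ F, j ∉ Set.Icc 1 G.possibleEdges.card) →
      binaryCode (0 : ℕ) ∈ U (binaryCode j) p₂)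

/-! ### Disjoint paths -/

/-- `S` is a set of paths of length `l` from `u` to `v`, any two of which have no vertex in common
except `u` and `v`. -/
def IsDisjointPathSet {W : Type*} (H : SimpleGraph W) (u v : W) (l : ℕ)
    (S : Finset (H.Walk u v)) : Prop :=
  (∀ p ∈ S, p.IsPath ∧ p.length = l) ∧
  ∀ p ∈ S, ∀ q ∈ S, p ≠ q → ∀ x, x ∈ p.support → x ∈ q.support → x = u ∨ x = v

/-- The largest number of pairwise disjoint paths of length `l` from `u` to `v` is `m`. -/
def IsMaxDisjointPaths {W : Type*} (H : SimpleGraph W) (u v : W) (l m : ℕ) : Prop :=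
  IsGreatest {k : ℕ | ∃ S : Finset (H.Walk u v), S.card = k ∧ IsDisjointPathSet H u v l S} m

/-! The argument is incompressibility applied to a rare, decidable property. Write `N` for the order
and `ℓ` for `N.size`, and view a graph as a vector of `N.choose 2` bits. For vertices `u`, `v`,
count the other vertices `w` that are adjacent to `u` (if `u = v`), or to exactly one of `u`, `v`
(if `u ≠ v`). In a uniformly random vector these events, for different `w`, are independent fair
bits: the XOR of two distinct edge bits is again fair. Hence one Chernoff bound covers both cases,
and a union bound over the `N ^ 2` pairs leaves at most a fraction `2 ^ (-q * ℓ)` of irregular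
vectors, where the deviation constant is `q + 3` (`ListsPairs.length_irregularList_mul_le`).

Irregularity is decidable from `N` and the labeling, so an irregular graph can be described, given
`N`, by its position in the list of all irregular vectors (`irregularString`,
`IsUniversal.exists_plainComplexity_le`). This saves about `q * ℓ` bits, more than the randomness
deficiency `δ` allows once `q` exceeds its logarithmic constant. So large members are regular
(`exists_forall_not_deviates`).

The case `u = v` gives the degrees. For `u ≠ v`, the identity deg u + deg v = (symmetric difference)
+ 2 (common neighbours), up to the vertices `u` and `v` themselves, puts the common neighbours near
`N / 4` (`card_filter_estimates`). These are the midpoints of the paths of length 2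
(`isMaxDisjointPaths_two`). Every pair then has a common neighbour while no vertex is adjacent to
all others, so the diameter is 2. -/

/-! ### Computability of the binary representation -/

/-- The natural number with the given binary digits, the least significant one first. -/
def natOfBits (l : List Bool) : ℕ := l.foldr Nat.bit 0

theorem natOfBits_bits (n : ℕ) : natOfBits n.bits = n := by
  induction n using Nat.binaryRec' with
  | zero => simp [natOfBits]
  | bit b n h ih =>
    rw [Nat.bits_append_bit n b h]
    simpa [natOfBits] using congrArg (Nat.bit b) ih

theorem primrec₂_bit : Primrec₂ Nat.bit := by
  have : Primrec fun p : Bool × ℕ => cond p.1 (2 * p.2 + 1) (2 * p.2) :=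
    Primrec.cond Primrec.fst (Primrec.nat_double_succ.comp Primrec.snd)
      (Primrec.nat_double.comp Primrec.snd)
  exact this.of_eq fun p => by cases p.1 <;> simp [Nat.bit]

theorem primrec_natOfBits : Primrec natOfBits :=
  Primrec.list_foldr (h := fun _ p => Nat.bit p.1 p.2) Primrec.id (Primrec.const 0)
    (primrec₂_bit.comp (Primrec.fst.comp Primrec.snd) (Primrec.snd.comp Primrec.snd)).to₂

/-- The binary digits of the successor, computed from the binary digits. -/
def bitsSucc (l : List Bool) : List Bool :=
  List.rec [true] (fun b t ih => cond b (false :: ih) (true :: t)) l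

theorem bits_succ (n : ℕ) : (n + 1).bits = bitsSucc n.bits := by
  induction n using Nat.binaryRec' with
  | zero => simp [bitsSucc]
  | bit b n h ih =>
    rw [Nat.bits_append_bit n b h]
    cases b with
    | false =>
      have : Nat.bit false n + 1 = 2 * n + 1 := by simp [Nat.bit]
      rw [this, Nat.bit1_bits]
      rfl
    | true =>
      have : Nat.bit true n + 1 = 2 * (n + 1) := by simp [Nat.bit]; ring
      rw [this, Nat.bit0_bits _ n.succ_ne_zero, ih]
      rfl

theorem primrec_bitsSucc : Primrec bitsSucc :=
  Primrec.list_rec (h := fun _ p => cond p.1 (false :: p.2.2) (true :: p.2.1))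
    Primrec.id (Primrec.const [true])
    (Primrec.cond (Primrec.fst.comp Primrec.snd)
      (Primrec.list_cons.comp (Primrec.const false)
        (Primrec.snd.comp (Primrec.snd.comp Primrec.snd)))
      (Primrec.list_cons.comp (Primrec.const true)
        (Primrec.fst.comp (Primrec.snd.comp Primrec.snd)))).to₂

/-- Incrementing a digit string repeatedly, starting from `[]`, makes the binary expansion a plain
recursion on `n`. -/
theorem primrec_bits : Primrec Nat.bits :=
  (Primrec.nat_rec₁ (f := fun _ l => bitsSucc l) []
    (primrec_bitsSucc.comp Primrec.snd).to₂).of_eq fun n => by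
      induction n with
      | zero => simp
      | succ n ih => rw [bits_succ, ← ih]

theorem primrec_binaryCode {α : Type*} [Primcodable α] : Primrec (binaryCode : α → List Bool) :=
  primrec_bits.comp Primrec.encode

theorem primrec₂_pow : Primrec₂ ((· ^ ·) : ℕ → ℕ → ℕ) :=
  Primrec₂.unpaired'.1 Nat.Primrec.pow

theorem primrec₂_testBit : Primrec₂ Nat.testBit := by
  have : PrimrecPred fun p : ℕ × ℕ => p.1 / 2 ^ p.2 % 2 = 1 :=
    Primrec.eq.comp (Primrec.nat_mod.comp (Primrec.nat_div.comp Primrec.fst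
      (primrec₂_pow.comp (Primrec.const 2) Primrec.snd)) (Primrec.const 2)) (Primrec.const 1)
  exact this.decide.of_eq fun p => by simp [Nat.testBit_eq_decide_div_mod_eq]

theorem primrec_size : Primrec Nat.size :=
  (Primrec.list_length.comp primrec_bits).of_eq Nat.size_eq_bits_len

theorem Primrec.list_filter_param {β γ : Type*} [Primcodable β] [Primcodable γ] {f : β → List γ}
    {p : β → γ → Prop} [∀ b c, Decidable (p b c)] (hf : Primrec f)
    (hp : PrimrecPred fun x : β × γ => p x.1 x.2) :
    Primrec fun b => (f b).filter (p b ·) := by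
  refine (Primrec.listFilterMap (g := fun b c => if p b c then some c else none) hf
    (Primrec.ite hp (Primrec.option_some.comp Primrec.snd) (Primrec.const none))).of_eq fun b => ?_
  induction f b with
  | nil => rfl
  | cons c l ih => by_cases h : p b c <;> simp [h, ih]

/-! ### Deviations in graphs given by bit vectors -/

section EdgeLists

variable {α : Type*} [DecidableEq α]

/-- The neighbours of `u` in the graph with the edges `L`. -/
def neighborList (L : List (α × α)) (u : α) : List α :=
  L.filterMap fun p => if p.1 = u then some p.2 else if p.2 = u then some p.1 else none

/-- The entries of `L` whose positions are binary digits `1` of `m`. -/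
def selectBits (L : List (α × α)) (m : ℕ) : List (α × α) :=
  (List.range L.length).filterMap fun j => if m.testBit j then L[j]? else none

/-- For `u ≠ v`: exactly one of `u`, `v` is joined to `w` by an edge in `E`. For `u = v`: the
vertex `u` is joined to `w`. -/
def Separates (E : List (α × α)) (u v w : α) : Prop :=
  (w ∈ neighborList E u ∧ ¬ (u ≠ v ∧ w ∈ neighborList E v)) ∨
    ((u ≠ v ∧ w ∈ neighborList E v) ∧ w ∉ neighborList E u)

instance (E : List (α × α)) (u v w : α) : Decidable (Separates E u v w) :=
  inferInstanceAs (Decidable (_ ∨ _))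

/-- The vertices other than `u` and `v`, in the complete graph with the edges `L`. -/
def otherVertices (L : List (α × α)) (u v : α) : List α :=
  (neighborList L u).filter (· ≠ v)

/-- The number of vertices that are separated. -/
def separatedCount (L E : List (α × α)) (u v : α) : ℕ :=
  ((otherVertices L u v).filter (Separates E u v ·)).length

/-- The number of separated vertices is far from half of the number of vertices. -/
def Deviates (κ N : ℕ) (L E : List (α × α)) (u v : α) : Prop :=
  -- One of the two truncated differences vanishes, so their sum is an absolute value. Squaring it
  -- avoids roots and keeps the test inside natural-number arithmetic.
  2 * κ * N * N.size ≤
    ((2 * separatedCount L E u v - (otherVertices L u v).length) +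
      ((otherVertices L u v).length - 2 * separatedCount L E u v)) ^ 2

instance (κ N : ℕ) (L E : List (α × α)) (u v : α) : Decidable (Deviates κ N L E u v) :=
  inferInstanceAs (Decidable (_ ≤ _))

/-- The graph that `m` selects from the complete graph with the edges `L` has a deviation. -/
def Irregular (κ N : ℕ) (L : List (α × α)) (m : ℕ) : Prop :=
  ∃ u ∈ L.flatMap (fun p => [p.1, p.2]), ∃ v ∈ L.flatMap (fun p => [p.1, p.2]),
    Deviates κ N L (selectBits L m) u v

instance (κ N : ℕ) (L : List (α × α)) (m : ℕ) : Decidable (Irregular κ N L m) :=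
  inferInstanceAs (Decidable (∃ u ∈ _, ∃ v ∈ _, _))

end EdgeLists

/-! ### Primitive recursiveness of the irregularity test -/

section Primrec

variable {α : Type*} [Primcodable α]

theorem primrecRel_mem : PrimrecRel fun (a : α) (l : List α) => a ∈ l :=
  ((PrimrecRel.exists_mem_list (R := fun a b : α => a = b) Primrec.eq).comp
    Primrec.snd Primrec.fst).of_eq fun p => by simp

theorem primrec₂_selectBits : Primrec₂ (selectBits : List (α × α) → ℕ → List (α × α)) := by
  refine (Primrec.listFilterMap (f := fun q : List (α × α) × ℕ => List.range q.1.length)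
    (g := fun (q : List (α × α) × ℕ) (j : ℕ) => if q.2.testBit j then q.1[j]? else none)
    (Primrec.list_range.comp (Primrec.list_length.comp Primrec.fst)) ?_).to₂
  exact Primrec.ite
    (Primrec.eq.comp (primrec₂_testBit.comp (Primrec.snd.comp Primrec.fst) Primrec.snd)
      (Primrec.const true))
    (Primrec.list_getElem?.comp (Primrec.fst.comp Primrec.fst) Primrec.snd) (Primrec.const none)

variable [DecidableEq α]

theorem primrec₂_neighborList : Primrec₂ (neighborList : List (α × α) → α → List α) := by
  refine (Primrec.listFilterMap (f := Prod.fst) (g := fun (q : List (α × α) × α) (p : α × α) =>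
    if p.1 = q.2 then some p.2 else if p.2 = q.2 then some p.1 else none) Primrec.fst ?_).to₂
  have h1 : Primrec fun x : (List (α × α) × α) × (α × α) => x.2.1 :=
    Primrec.fst.comp Primrec.snd
  have h2 : Primrec fun x : (List (α × α) × α) × (α × α) => x.2.2 :=
    Primrec.snd.comp Primrec.snd
  have h3 : Primrec fun x : (List (α × α) × α) × (α × α) => x.1.2 :=
    Primrec.snd.comp Primrec.fst
  exact Primrec.ite (Primrec.eq.comp h1 h3) (Primrec.option_some.comp h2)
    (Primrec.ite (Primrec.eq.comp h2 h3) (Primrec.option_some.comp h1) (Primrec.const none))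

theorem primrecPred_separates :
    PrimrecPred fun x : List (α × α) × α × α × α => Separates x.1 x.2.1 x.2.2.1 x.2.2.2 := by
  have hE : Primrec fun x : List (α × α) × α × α × α => x.1 := Primrec.fst
  have hu : Primrec fun x : List (α × α) × α × α × α => x.2.1 := Primrec.fst.comp Primrec.snd
  have hv : Primrec fun x : List (α × α) × α × α × α => x.2.2.1 :=
    Primrec.fst.comp (Primrec.snd.comp Primrec.snd)
  have hw : Primrec fun x : List (α × α) × α × α × α => x.2.2.2 :=
    Primrec.snd.comp (Primrec.snd.comp Primrec.snd)
  have hA := primrecRel_mem.comp hw (primrec₂_neighborList.comp hE hu)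
  have hB := ((Primrec.eq.comp hu hv).not).and
    (primrecRel_mem.comp hw (primrec₂_neighborList.comp hE hv))
  exact (hA.and hB.not).or (hB.and hA.not)

theorem primrec_otherVertices :
    Primrec fun x : List (α × α) × α × α => otherVertices x.1 x.2.1 x.2.2 :=
  Primrec.list_filter_param (p := fun (x : List (α × α) × α × α) (w : α) => w ≠ x.2.2)
    (primrec₂_neighborList.comp Primrec.fst (Primrec.fst.comp Primrec.snd))
    (Primrec.eq.comp Primrec.snd
      (Primrec.snd.comp (Primrec.snd.comp Primrec.fst))).not

theorem primrec_separatedCount :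
    Primrec fun x : (List (α × α) × List (α × α)) × α × α =>
      separatedCount x.1.1 x.1.2 x.2.1 x.2.2 := by
  refine Primrec.list_length.comp (Primrec.list_filter_param
    (p := fun (x : (List (α × α) × List (α × α)) × α × α) (w : α) =>
      Separates x.1.2 x.2.1 x.2.2 w) ?_ ?_)
  · exact primrec_otherVertices.comp (Primrec.pair (Primrec.fst.comp Primrec.fst) Primrec.snd)
  · exact primrecPred_separates.comp (Primrec.pair
      (Primrec.snd.comp (Primrec.fst.comp Primrec.fst))
      (Primrec.pair (Primrec.fst.comp (Primrec.snd.comp Primrec.fst))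
        (Primrec.pair (Primrec.snd.comp (Primrec.snd.comp Primrec.fst)) Primrec.snd)))

theorem primrecPred_deviates (κ : ℕ) :
    PrimrecPred fun x : ℕ × (List (α × α) × List (α × α)) × α × α =>
      Deviates κ x.1 x.2.1.1 x.2.1.2 x.2.2.1 x.2.2.2 := by
  have hc : Primrec fun x : ℕ × (List (α × α) × List (α × α)) × α × α =>
      2 * separatedCount x.2.1.1 x.2.1.2 x.2.2.1 x.2.2.2 :=
    Primrec.nat_double.comp (primrec_separatedCount.comp Primrec.snd)
  have ho : Primrec fun x : ℕ × (List (α × α) × List (α × α)) × α × α =>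
      (otherVertices x.2.1.1 x.2.2.1 x.2.2.2).length :=
    Primrec.list_length.comp (primrec_otherVertices.comp (Primrec.pair
      (Primrec.fst.comp (Primrec.fst.comp Primrec.snd)) (Primrec.snd.comp Primrec.snd)))
  exact Primrec.nat_le.comp
    (Primrec.nat_mul.comp (Primrec.nat_mul.comp (Primrec.const (2 * κ)) Primrec.fst)
      (primrec_size.comp Primrec.fst))
    (primrec₂_pow.comp (Primrec.nat_add.comp (Primrec.nat_sub.comp hc ho)
      (Primrec.nat_sub.comp ho hc)) (Primrec.const 2))

theorem primrecPred_irregular (κ : ℕ) :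
    PrimrecPred fun x : (ℕ × List (α × α)) × ℕ => Irregular κ x.1.1 x.1.2 x.2 := by
  have hV : Primrec fun L : List (α × α) => L.flatMap fun p => [p.1, p.2] :=
    Primrec.list_flatMap Primrec.id (Primrec.list_cons.comp (Primrec.fst.comp Primrec.snd)
      (Primrec.list_cons.comp (Primrec.snd.comp Primrec.snd) (Primrec.const []))).to₂
  have h1 : PrimrecRel fun (v : α) (x : ((ℕ × List (α × α)) × ℕ) × α) =>
      Deviates κ x.1.1.1 x.1.1.2 (selectBits x.1.1.2 x.1.2) x.2 v := by
    refine (primrecPred_deviates (α := α) κ).comp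
      (f := fun y : α × ((ℕ × List (α × α)) × ℕ) × α =>
      (y.2.1.1.1, (y.2.1.1.2, selectBits y.2.1.1.2 y.2.1.2), y.2.2, y.1)) ?_
    have hx := Primrec.fst.comp (Primrec.snd (α := α) (β := ((ℕ × List (α × α)) × ℕ) × α))
    have hL := Primrec.snd.comp (Primrec.fst.comp hx)
    exact Primrec.pair (Primrec.fst.comp (Primrec.fst.comp hx))
      (Primrec.pair (Primrec.pair hL (primrec₂_selectBits.comp hL (Primrec.snd.comp hx)))
        (Primrec.pair (Primrec.snd.comp Primrec.snd) Primrec.fst))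
  have h2 : PrimrecRel fun (u : α) (x : (ℕ × List (α × α)) × ℕ) =>
      ∃ v ∈ x.1.2.flatMap (fun p => [p.1, p.2]),
        Deviates κ x.1.1 x.1.2 (selectBits x.1.2 x.2) u v :=
    h1.exists_mem_list.comp
      (hV.comp (Primrec.snd.comp (Primrec.fst.comp Primrec.snd)))
      (Primrec.pair Primrec.snd Primrec.fst)
  exact h2.exists_mem_list.comp (hV.comp (Primrec.snd.comp Primrec.fst)) Primrec.id

end Primrec

/-! ### Description of irregular graphs by their positions -/

section Decompression

variable {α : Type*}

/-- The entries of `L`, each with the binary digit of `m` at its position. -/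
def tagBits (L : List (α × α)) (m : ℕ) : List ((α × α) × Bool) :=
  (List.range L.length).filterMap fun j => L[j]?.map fun p => (p, m.testBit j)

/-- The irregular bit vectors in increasing order. -/
def irregularList [DecidableEq α] (κ N : ℕ) (L : List (α × α)) : List ℕ :=
  (List.range (2 ^ L.length)).filter (Irregular κ N L ·)

theorem tagBits_map_range (f : ℕ → α × α) (n m : ℕ) :
    tagBits ((List.range n).map f) m = (List.range n).map fun j => (f j, m.testBit j) := by
  unfold tagBits
  rw [List.length_map, List.length_range]
  refine (List.filterMap_congr (g := some ∘ fun j => (f j, m.testBit j)) fun j hj => ?_).trans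
    (congrFun List.filterMap_eq_map _)
  simp [List.mem_range.1 hj]

variable [Primcodable α]

theorem primrec₂_tagBits : Primrec₂ (tagBits : List (α × α) → ℕ → List ((α × α) × Bool)) := by
  refine (Primrec.listFilterMap (f := fun q : List (α × α) × ℕ => List.range q.1.length)
    (g := fun (q : List (α × α) × ℕ) (j : ℕ) => q.1[j]?.map fun p => (p, q.2.testBit j))
    (Primrec.list_range.comp (Primrec.list_length.comp Primrec.fst)) ?_).to₂
  exact Primrec.option_map
    (Primrec.list_getElem?.comp (Primrec.fst.comp Primrec.fst) Primrec.snd)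
    (Primrec.pair Primrec.snd (primrec₂_testBit.comp
      (Primrec.snd.comp (Primrec.fst.comp Primrec.fst)) (Primrec.snd.comp Primrec.fst))).to₂

theorem primrec_irregularList [DecidableEq α] (κ : ℕ) :
    Primrec fun x : ℕ × List (α × α) => irregularList κ x.1 x.2 :=
  Primrec.list_filter_param (p := fun (x : ℕ × List (α × α)) (m : ℕ) => Irregular κ x.1 x.2 m)
    (Primrec.list_range.comp (primrec₂_pow.comp (Primrec.const 2)
      (Primrec.list_length.comp Primrec.snd)))
    (primrecPred_irregular κ)

/-- The labeling is only known to be computable, so this is where primitive recursion is left; the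
operations applied to the resulting list are primitive recursive again. -/
theorem computable_map_range {f : ℕ → α} (hf : Computable f) :
    Computable fun n => (List.range n).map f := by
  refine (Computable.nat_rec (f := fun n : ℕ => n) (g := fun _ => ([] : List α))
    (h := fun _ p => p.2 ++ [f p.1]) Computable.id (Computable.const [])
    (Computable.list_concat.comp (Computable.snd.comp Computable.snd)
      (hf.comp (Computable.fst.comp Computable.snd))).to₂).of_eq fun n => ?_
  induction n with
  | zero => rfl
  | succ n ih => simpa [List.range_succ] using ih

/-- The string for the irregular graph at the position `i`. -/
def irregularString [DecidableEq α] (κ : ℕ) (f : ℕ → α × α) (N i : ℕ) : List Bool :=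
  -- The number of edges and the deviation threshold depend on `N` alone, so `N` and `i` suffice to
  -- rebuild the string. The default `0` only makes the function total; it does not matter for
  -- positions inside the list.
  binaryCode (tagBits ((List.range (N * (N - 1) / 2)).map f)
    ((irregularList κ N ((List.range (N * (N - 1) / 2)).map f)).getD i 0))

theorem computable₂_irregularString [DecidableEq α] (κ : ℕ) {f : ℕ → α × α} (hf : Computable f) :
    Computable₂ (irregularString κ f) := by
  have hn : Primrec fun x : ℕ × ℕ => x.1 * (x.1 - 1) / 2 :=
    Primrec.nat_div.comp (Primrec.nat_mul.comp Primrec.fst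
      (Primrec.nat_sub.comp Primrec.fst (Primrec.const 1))) (Primrec.const 2)
  have hL : Computable fun x : ℕ × ℕ => (List.range (x.1 * (x.1 - 1) / 2)).map f :=
    (computable_map_range hf).comp hn.to_comp
  have hm : Computable fun x : ℕ × ℕ =>
      (irregularList κ x.1 ((List.range (x.1 * (x.1 - 1) / 2)).map f)).getD x.2 0 :=
    (Primrec.list_getD 0).to_comp.comp ((primrec_irregularList κ).to_comp.comp
      (Computable.pair Computable.fst hL)) Computable.snd
  exact primrec_binaryCode.to_comp.comp (primrec₂_tagBits.to_comp.comp hL hm)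

end Decompression

/-- The output of a total computable function of two numbers has complexity at most the length of
the second number, up to a constant. -/
theorem IsUniversal.exists_plainComplexity_le {U : Machine} (hU : IsUniversal U)
    {D : ℕ → ℕ → List Bool} (hD : Computable₂ D) :
    ∃ c, ∀ N i, plainComplexity U (D N i) (binaryCode N) ≤ i.size + c := by
  obtain ⟨τ, c, hτ, h⟩ := hU.simulates
    (fun x w => Part.some (D (natOfBits x) (natOfBits w)))
    (hD.comp (primrec_natOfBits.to_comp.comp Computable.fst)
      (primrec_natOfBits.to_comp.comp Computable.snd))
  refine ⟨c, fun N i => ?_⟩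
  have hmem : D N i ∈ U (binaryCode N) (τ i.bits) := by
    rw [h, binaryCode, natOfBits_bits, natOfBits_bits]
    simp
  exact (Nat.sInf_le (s := {l | ∃ w : List Bool, w.length = l ∧ _ ∈ U _ w})
    ⟨_, rfl, hmem⟩).trans ((hτ _).trans_eq (by rw [Nat.size_eq_bits_len]))

/-- In a recursively labeled family the sequence of edges agrees with a total computable one. -/
theorem IsRecursivelyLabeled.exists_computable {U : Machine} (hU : IsUniversal U)
    {F : Set SimpleTVG} {e : ℕ → CompositeVertex × CompositeVertex}
    (h : IsRecursivelyLabeled U F e) :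
    ∃ f : ℕ → CompositeVertex × CompositeVertex, Computable f ∧
      ∀ G ∈ F, ∀ i < G.possibleEdges.card, f i = e (i + 1) := by
  obtain ⟨-, p₁, p₂, -, -, h₃, h₄⟩ := h
  -- The program also halts on indices outside the family, where it signals `0`; this makes the
  -- decoder total.
  have hdom : ∀ j, (U (binaryCode (j : ℕ)) p₂).Dom := by
    intro j
    by_cases hj : ∀ G ∈ F, j ∉ Set.Icc 1 G.possibleEdges.card
    · exact Part.dom_iff_mem.2 ⟨_, h₄ j hj⟩
    · push Not at hj
      obtain ⟨G, hG, hj⟩ := hj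
      exact Part.dom_iff_mem.2 ⟨_, h₃ G hG j hj⟩
  have hg : Computable fun j => (U (binaryCode (j : ℕ)) p₂).get (hdom j) := by
    refine Partrec.of_eq (f := fun j : ℕ => U (binaryCode (j : ℕ)) p₂) ?_ fun j => (Part.some_get _).symm
    exact hU.partrec.comp primrec_binaryCode.to_comp (Computable.const p₂)
  refine ⟨fun i => Denumerable.ofNat _ (natOfBits ((U (binaryCode (i + 1)) p₂).get (hdom (i + 1)))),
    (Computable.ofNat _).comp (primrec_natOfBits.to_comp.comp (hg.comp Computable.succ)),
    fun G hG i hi => ?_⟩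
  refine (congrArg (fun l => Denumerable.ofNat _ (natOfBits l))
    (Part.get_eq_of_mem (h₃ G hG (i + 1) ⟨by omega, hi⟩) (hdom (i + 1)))).trans ?_
  simp only [binaryCode, natOfBits_bits]
  exact Denumerable.ofNat_encode _

/-! ### Counting irregular bit vectors -/

/-- Flipping the digit `j < n` is an involution of the `n`-bit numbers. -/
theorem sum_range_two_pow_xor {M : Type*} [AddCommMonoid M] {n j : ℕ} (hj : j < n) (F : ℕ → M) :
    ∑ m ∈ Finset.range (2 ^ n), F (m ^^^ 2 ^ j) = ∑ m ∈ Finset.range (2 ^ n), F m := by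
  have h : ∀ m ∈ Finset.range (2 ^ n), m ^^^ 2 ^ j ∈ Finset.range (2 ^ n) := fun m hm =>
    Finset.mem_range.2 (Nat.xor_lt_two_pow (Finset.mem_range.1 hm)
      (Nat.pow_lt_pow_right one_lt_two hj))
  refine Finset.sum_nbij' (· ^^^ 2 ^ j) (· ^^^ 2 ^ j) h h ?_ ?_ fun _ _ => rfl
  all_goals intro m _; simp

/-- If every statistic `b w` is negated by flipping a bit that the other statistics do not depend
on, then the statistics behave as independent unbiased bits. -/
theorem sum_prod_of_flip {ι : Type*} (n : ℕ) (W : Finset ι) (b : ι → ℕ → Bool) (j : ι → ℕ)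
    (hj : ∀ w ∈ W, j w < n) (hflip : ∀ w ∈ W, ∀ m, b w (m ^^^ 2 ^ j w) = !b w m)
    (hother : ∀ w ∈ W, ∀ w' ∈ W, w' ≠ w → ∀ m, b w' (m ^^^ 2 ^ j w) = b w' m)
    (f : Bool → ℝ) :
    ∑ m ∈ Finset.range (2 ^ n), ∏ w ∈ W, f (b w m) =
      2 ^ n * ((f true + f false) / 2) ^ W.card := by
  classical
  induction W using Finset.induction_on with
  | empty => simp
  | insert w W hw ih =>
    simp only [Finset.mem_insert, forall_eq_or_imp] at hj hflip hother
    have ih := ih hj.2 hflip.2 fun w hw w' hw' => (hother.2 w hw).2 w' hw'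
    -- Pair `m` with its flip at `j w`: the factor of `w` takes both values, and all other factors
    -- stay the same.
    have key : ∀ m, ∏ v ∈ insert w W, f (b v m) + ∏ v ∈ insert w W, f (b v (m ^^^ 2 ^ j w)) =
        (f true + f false) * ∏ v ∈ W, f (b v m) := by
      intro m
      have h : ∏ v ∈ W, f (b v (m ^^^ 2 ^ j w)) = ∏ v ∈ W, f (b v m) :=
        Finset.prod_congr rfl fun v hv => by rw [hother.1.2 v hv (fun h => hw (h ▸ hv)) m]
      rw [Finset.prod_insert hw, Finset.prod_insert hw, hflip.1, h]
      cases b w m <;> simp <;> ring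
    have h2 : 2 * ∑ m ∈ Finset.range (2 ^ n), ∏ v ∈ insert w W, f (b v m) =
        (f true + f false) * ∑ m ∈ Finset.range (2 ^ n), ∏ v ∈ W, f (b v m) := by
      rw [two_mul]
      nth_rewrite 2 [← sum_range_two_pow_xor hj.1]
      rw [← Finset.sum_add_distrib, Finset.mul_sum]
      exact Finset.sum_congr rfl fun m _ => key m
    rw [Finset.card_insert_of_notMem hw, pow_succ]
    rw [ih] at h2
    linarith

/-- The sign of a truth value. -/
def boolSign (b : Bool) : ℝ := if b then 1 else -1

/-- The Chernoff bound, for the number of bit vectors with a large sum of signs. -/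
theorem card_sum_boolSign_ge_le {ι : Type*} (n : ℕ) (W : Finset ι) (b : ι → ℕ → Bool) (j : ι → ℕ)
    (hj : ∀ w ∈ W, j w < n) (hflip : ∀ w ∈ W, ∀ m, b w (m ^^^ 2 ^ j w) = !b w m)
    (hother : ∀ w ∈ W, ∀ w' ∈ W, w' ≠ w → ∀ m, b w' (m ^^^ 2 ^ j w) = b w' m)
    {N a : ℝ} (hN : 0 < N) (hW : (W.card : ℝ) ≤ N) (ha : 0 ≤ a) :
    (((Finset.range (2 ^ n)).filter fun m => 2 * a * N ≤ (∑ w ∈ W, boolSign (b w m)) ^ 2).card : ℝ)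
      ≤ 2 * 2 ^ n * Real.exp (-a) := by
  -- The event is `|S| ≥ t`, and `r = t / N` minimises `N * s ^ 2 / 2 - s * t` over `s`. Then `N * r
  -- ^ 2 / 2 = a` and `r * t = 2 * a`. The moments at `r` and `-r` handle the two tails.
  set t := Real.sqrt (2 * a * N) with ht
  set r := t / N with hr
  have ht2 : t ^ 2 = 2 * a * N := Real.sq_sqrt (by positivity)
  have hexp : ∀ s : ℝ, s ^ 2 = r ^ 2 →
      ∑ m ∈ Finset.range (2 ^ n), Real.exp (s * ∑ w ∈ W, boolSign (b w m)) ≤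
        2 ^ n * Real.exp a := by
    intro s hs
    have h1 := sum_prod_of_flip n W b j hj hflip hother fun c => Real.exp (s * boolSign c)
    simp only [← Real.exp_sum, ← Finset.mul_sum] at h1
    rw [h1]
    gcongr
    have h2 : (Real.exp (s * boolSign true) + Real.exp (s * boolSign false)) / 2 = Real.cosh s := by
      simp [boolSign, Real.cosh_eq]
    rw [h2]
    calc Real.cosh s ^ W.card ≤ Real.exp (s ^ 2 / 2) ^ W.card :=
          pow_le_pow_left₀ (Real.cosh_pos s).le (Real.cosh_le_exp_half_sq s) _
      _ = Real.exp (W.card * (s ^ 2 / 2)) := (Real.exp_nat_mul _ _).symm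
      _ ≤ Real.exp a := by
          refine Real.exp_le_exp.2 ((mul_le_mul_of_nonneg_right hW (by positivity)).trans_eq ?_)
          rw [hs, hr, div_pow, ht2]
          field_simp
  have hpt : ∀ m ∈ (Finset.range (2 ^ n)).filter
      (fun m => 2 * a * N ≤ (∑ w ∈ W, boolSign (b w m)) ^ 2),
      Real.exp (2 * a) ≤ Real.exp (r * ∑ w ∈ W, boolSign (b w m)) +
        Real.exp (-r * ∑ w ∈ W, boolSign (b w m)) := by
    intro m hm
    have hm := (Finset.mem_filter.1 hm).2
    rw [← ht2] at hm
    set S := ∑ w ∈ W, boolSign (b w m)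
    have habs : t ≤ |S| := (le_abs_self t).trans (sq_le_sq.1 hm)
    have hrt : r * t = 2 * a := by rw [hr, div_mul_eq_mul_div, ← sq, ht2]; field_simp
    have hr0 : 0 ≤ r := by positivity
    rcases le_abs.1 habs with h | h
    · have : 2 * a ≤ r * S := hrt ▸ mul_le_mul_of_nonneg_left h hr0
      linarith [Real.exp_le_exp.2 this, Real.exp_pos (-r * S)]
    · have : 2 * a ≤ -r * S := by
        have := mul_le_mul_of_nonneg_left h hr0
        rw [hrt] at this
        linarith
      linarith [Real.exp_le_exp.2 this, Real.exp_pos (r * S)]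
  have hsum := (Finset.card_nsmul_le_sum _ _ _ hpt).trans
    (Finset.sum_le_sum_of_subset_of_nonneg (Finset.filter_subset _ _) fun _ _ _ => by positivity)
  rw [Finset.sum_add_distrib, nsmul_eq_mul] at hsum
  have h := hsum.trans (add_le_add (hexp r rfl) (hexp (-r) (neg_sq r)))
  have h3 : Real.exp (2 * a) = Real.exp a * Real.exp a := by rw [← Real.exp_add]; ring_nf
  have h4 : Real.exp a * Real.exp (-a) = 1 := by rw [← Real.exp_add]; simp
  rw [h3] at h
  have hpos := Real.exp_pos (-a)
  set X : ℝ := (((Finset.range (2 ^ n)).filter fun m =>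
    2 * a * N ≤ (∑ w ∈ W, boolSign (b w m)) ^ 2).card : ℝ)
  clear_value X
  calc X = X * (Real.exp a * Real.exp a) * Real.exp (-a) ^ 2 := by
        linear_combination (-X) * (Real.exp a * Real.exp (-a) + 1) * h4
    _ ≤ (2 ^ n * Real.exp a + 2 ^ n * Real.exp a) * Real.exp (-a) ^ 2 := by gcongr
    _ = 2 * 2 ^ n * (Real.exp a * Real.exp (-a)) * Real.exp (-a) := by ring
    _ = 2 * 2 ^ n * Real.exp (-a) := by rw [h4, mul_one]

theorem Nat.cast_sub_add_sub_eq_abs (a b : ℕ) : (((a - b) + (b - a) : ℕ) : ℝ) = |(a : ℝ) - b| := by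
  rcases le_total a b with hab | hab
  · rw [Nat.sub_eq_zero_of_le hab, zero_add, Nat.cast_sub hab, abs_sub_comm,
      abs_of_nonneg (sub_nonneg.2 (Nat.cast_le.2 hab))]
  · rw [Nat.sub_eq_zero_of_le hab, add_zero, Nat.cast_sub hab,
      abs_of_nonneg (sub_nonneg.2 (Nat.cast_le.2 hab))]

theorem sum_boolSign {ι : Type*} (W : Finset ι) (p : ι → Prop) [DecidablePred p] :
    ∑ w ∈ W, boolSign (decide (p w)) = 2 * ((W.filter p).card : ℝ) - (W.card : ℝ) := by
  have : ∀ w, boolSign (decide (p w)) = 2 * (if p w then 1 else 0) - 1 := by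
    intro w
    by_cases hw : p w <;> norm_num [boolSign, hw]
  simp only [this, Finset.sum_sub_distrib, ← Finset.mul_sum, Finset.sum_boole]
  simp

/-! ### Edge positions as independent bits, and the union bound -/

section PairListing

variable {α : Type*}

/-- The list `L` enumerates the unordered pairs of distinct elements of `A` without repetition. -/
structure ListsPairs (A : Finset α) (L : List (α × α)) : Prop where
  nodup : (L.map fun p => s(p.1, p.2)).Nodup
  mem_iff : ∀ a b, s(a, b) ∈ (L.map fun p => s(p.1, p.2)) ↔ a ∈ A ∧ b ∈ A ∧ a ≠ b

theorem mem_selectBits {L : List (α × α)} {m : ℕ} {p : α × α} :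
    p ∈ selectBits L m ↔ ∃ j, L[j]? = some p ∧ m.testBit j = true := by
  simp only [selectBits, List.mem_filterMap, List.mem_range]
  constructor
  · rintro ⟨j, -, h⟩
    split_ifs at h with hm
    exact ⟨j, h, hm⟩
  · rintro ⟨j, h, hm⟩
    exact ⟨j, (List.getElem?_eq_some_iff.1 h).1, by simp [hm, h]⟩

variable [DecidableEq α]

theorem mem_neighborList {L : List (α × α)} {a b : α} :
    b ∈ neighborList L a ↔ s(a, b) ∈ L.map fun p => s(p.1, p.2) := by
  simp only [neighborList, List.mem_filterMap, List.mem_map, Sym2.eq_iff]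
  refine exists_congr fun p => and_congr_right fun _ => ?_
  by_cases h1 : p.1 = a <;> by_cases h2 : p.2 = a <;> simp [h1, h2]

/-- The position of an unordered pair in a list of pairs. -/
def pairIndex (L : List (α × α)) (x : Sym2 α) : ℕ := (L.map fun p => s(p.1, p.2)).idxOf x

namespace ListsPairs

variable {A : Finset α} {L : List (α × α)}

theorem pairIndex_lt (h : ListsPairs A L) {a b : α} (ha : a ∈ A) (hb : b ∈ A) (hab : a ≠ b) :
    pairIndex L s(a, b) < L.length := by
  have := List.idxOf_lt_length_iff.2 ((h.mem_iff a b).2 ⟨ha, hb, hab⟩)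
  simpa [pairIndex] using this

theorem pairIndex_inj (h : ListsPairs A L) {a b c d : α} (ha : a ∈ A) (hb : b ∈ A) (hab : a ≠ b) :
    pairIndex L s(a, b) = pairIndex L s(c, d) ↔ s(a, b) = s(c, d) :=
  List.idxOf_inj ((h.mem_iff a b).2 ⟨ha, hb, hab⟩)

/-- This is the bridge from graphs to bit vectors: since no pair is listed twice, adjacency is
governed by a single digit of `m`. -/
theorem mem_neighborList_selectBits (h : ListsPairs A L) {a b : α} (ha : a ∈ A) (hb : b ∈ A)
    (hab : a ≠ b) (m : ℕ) :
    b ∈ neighborList (selectBits L m) a ↔ m.testBit (pairIndex L s(a, b)) = true := by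
  have hmem := (h.mem_iff a b).2 ⟨ha, hb, hab⟩
  rw [mem_neighborList, List.mem_map]
  constructor
  · rintro ⟨p, hp, hpe⟩
    obtain ⟨j, hj, hm⟩ := mem_selectBits.1 hp
    obtain ⟨hlt, rfl⟩ := List.getElem?_eq_some_iff.1 hj
    have : pairIndex L s(a, b) = j := by
      have := h.nodup.idxOf_getElem j (by simpa using hlt)
      simpa [pairIndex, ← hpe] using this
    rwa [this]
  · intro hm
    have hlt := List.idxOf_lt_length_iff.2 hmem
    have hlt' := h.pairIndex_lt ha hb hab
    refine ⟨L[pairIndex L s(a, b)], mem_selectBits.2 ⟨_, List.getElem?_eq_getElem hlt', hm⟩, ?_⟩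
    have := List.getElem_idxOf hlt
    rw [List.getElem_map] at this
    exact this

theorem nodup_otherVertices (h : ListsPairs A L) (u v : α) : (otherVertices L u v).Nodup := by
  refine List.Nodup.filter _ ?_
  have hn := h.nodup
  rw [List.Nodup, List.pairwise_map] at hn
  rw [neighborList, List.Nodup, List.pairwise_filterMap]
  refine hn.imp fun {p q} hpq b hb c hc hbc => hpq ?_
  rw [Sym2.eq_iff]
  grind

theorem mem_otherVertices (h : ListsPairs A L) {u v w : α} (hu : u ∈ A) :
    w ∈ otherVertices L u v ↔ w ∈ A ∧ w ≠ u ∧ w ≠ v := by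
  rw [otherVertices, List.mem_filter, mem_neighborList, h.mem_iff]
  have : u = w ↔ w = u := eq_comm
  simp only [decide_eq_true_eq]
  tauto

theorem toFinset_otherVertices (h : ListsPairs A L) {u v : α} (hu : u ∈ A) :
    (otherVertices L u v).toFinset = (A.erase u).erase v := by
  ext w
  rw [List.mem_toFinset, h.mem_otherVertices hu]
  simp only [Finset.mem_erase]
  tauto

theorem length_otherVertices (h : ListsPairs A L) {u v : α} (hu : u ∈ A) :
    (otherVertices L u v).length = ((A.erase u).erase v).card := by
  rw [← h.toFinset_otherVertices hu, List.toFinset_card_of_nodup (h.nodup_otherVertices u v)]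

theorem separatedCount_eq (h : ListsPairs A L) {u v : α} (hu : u ∈ A) (E : List (α × α)) :
    separatedCount L E u v = (((A.erase u).erase v).filter (Separates E u v ·)).card := by
  rw [← h.toFinset_otherVertices hu, separatedCount,
    ← List.toFinset_card_of_nodup ((h.nodup_otherVertices u v).filter _), List.toFinset_filter]
  simp

theorem deviates_iff (h : ListsPairs A L) {u v : α} (hu : u ∈ A) (κ N : ℕ) (E : List (α × α)) :
    Deviates κ N L E u v ↔ (2 * κ * N * N.size : ℝ) ≤
      (2 * ((((A.erase u).erase v).filter (Separates E u v ·)).card : ℝ)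
        - (((A.erase u).erase v).card : ℝ)) ^ 2 := by
  rw [Deviates, ← Nat.cast_le (α := ℝ), Nat.cast_pow, Nat.cast_sub_add_sub_eq_abs, sq_abs, h.separatedCount_eq hu,
    h.length_otherVertices hu]
  push_cast
  rfl

/-- For `w` outside `{u, v}`, separation is the XOR of the digits at `uw` and `vw` (only `uw` if `u
= v`). The digit at `uw` occurs in the statistic of `w` and of no other vertex, so it can serve as
the flipping digit in `card_sum_boolSign_ge_le`, with `a = κ * A.card.size`. -/
theorem card_deviates_le (h : ListsPairs A L) {u v : α} (hu : u ∈ A) (hv : v ∈ A) (κ : ℕ) :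
    (((Finset.range (2 ^ L.length)).filter fun m =>
      Deviates κ A.card L (selectBits L m) u v).card : ℝ) ≤
      2 * 2 ^ L.length * Real.exp (-(κ * A.card.size)) := by
  have hA : (0 : ℝ) < A.card := Nat.cast_pos.2 (Finset.card_pos.2 ⟨u, hu⟩)
  set W := (A.erase u).erase v with hWdef
  have hW : ∀ w ∈ W, w ∈ A ∧ w ≠ u ∧ w ≠ v := fun w hw => by
    simp only [hWdef, Finset.mem_erase] at hw
    tauto
  set b : α → ℕ → Bool := fun w m => decide (Separates (selectBits L m) u v w) with hb
  have hbeq : ∀ w ∈ W, ∀ m, b w m = xor (m.testBit (pairIndex L s(u, w)))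
      (decide (u ≠ v) && m.testBit (pairIndex L s(v, w))) := by
    intro w hw m
    obtain ⟨hwA, hwu, hwv⟩ := hW w hw
    have e1 := h.mem_neighborList_selectBits hu hwA hwu.symm m
    have e2 := h.mem_neighborList_selectBits hv hwA hwv.symm m
    simp only [hb, Separates, e1, e2]
    by_cases huv : u = v <;> cases m.testBit (pairIndex L s(u, w)) <;>
      cases m.testBit (pairIndex L s(v, w)) <;> simp [huv]
  have hlt : ∀ w ∈ W, pairIndex L s(u, w) < L.length := fun w hw =>
    h.pairIndex_lt hu (hW w hw).1 (hW w hw).2.1.symm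
  have hcross : ∀ w ∈ W, ∀ w' ∈ W, u ≠ v → pairIndex L s(u, w) ≠ pairIndex L s(v, w') := by
    intro w hw w' hw' huv he
    rw [h.pairIndex_inj hu (hW w hw).1 (hW w hw).2.1.symm, Sym2.eq_iff] at he
    rcases he with ⟨he, -⟩ | ⟨-, he⟩
    · exact huv he
    · exact (hW w hw).2.2 he
  refine le_trans (Nat.cast_le.2 (Finset.card_le_card ?_))
    (card_sum_boolSign_ge_le L.length W b (fun w => pairIndex L s(u, w)) hlt ?_ ?_ hA
      (Nat.cast_le.2 (Finset.card_le_card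
        ((Finset.erase_subset _ _).trans (Finset.erase_subset _ _)))) (by positivity))
  · refine Finset.monotone_filter_right _ fun m _ hm => ?_
    rw [h.deviates_iff hu] at hm
    rw [sum_boolSign]
    linarith
  · intro w hw m
    rw [hbeq w hw, hbeq w hw, Nat.testBit_xor, Nat.testBit_xor, Nat.testBit_two_pow_self]
    by_cases huv : u = v
    · simp [huv]
    · rw [Nat.testBit_two_pow_of_ne (hcross w hw w hw huv)]
      simp
  · intro w hw w' hw' hne m
    rw [hbeq w' hw', hbeq w' hw', Nat.testBit_xor, Nat.testBit_xor,
      Nat.testBit_two_pow_of_ne (m := pairIndex L s(u, w'))]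
    · by_cases huv : u = v
      · simp [huv]
      · rw [Nat.testBit_two_pow_of_ne (hcross w hw w' hw' huv)]
        simp
    · rw [Ne, h.pairIndex_inj hu (hW w hw).1 (hW w hw).2.1.symm, Sym2.eq_iff]
      grind

/-- The test reads the vertices off the edge list; with at least two elements in `A`, each of them
is an end point of some listed pair. -/
theorem irregular_iff (h : ListsPairs A L) (hA : 2 ≤ A.card) {κ N m : ℕ} :
    Irregular κ N L m ↔ ∃ u ∈ A, ∃ v ∈ A, Deviates κ N L (selectBits L m) u v := by
  have hmem : ∀ u, u ∈ L.flatMap (fun p => [p.1, p.2]) ↔ u ∈ A := by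
    intro u
    constructor
    · intro hu
      obtain ⟨p, hp, hu⟩ := List.mem_flatMap.1 hu
      have := (h.mem_iff p.1 p.2).1 (List.mem_map.2 ⟨p, hp, rfl⟩)
      simp only [List.mem_cons, List.not_mem_nil, or_false] at hu
      rcases hu with rfl | rfl
      exacts [this.1, this.2.1]
    · intro hu
      obtain ⟨v, hv, hne⟩ := Finset.exists_mem_ne hA u
      obtain ⟨p, hp, he⟩ := List.mem_map.1 ((h.mem_iff u v).2 ⟨hu, hv, hne.symm⟩)
      refine List.mem_flatMap.2 ⟨p, hp, ?_⟩
      rcases Sym2.eq_iff.1 he with ⟨h1, -⟩ | ⟨-, h1⟩ <;> simp [← h1]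
  simp [Irregular, hmem]

/-- A union bound over ordered pairs. The `3` in `q + 3` pays for the two factors `A.card ≤ 2 ^ ℓ`
and for the factor `2 ≤ 2 ^ ℓ` of the two tails; `exp 1 ≥ 2` turns the exponential into a power of
2. -/
theorem length_irregularList_mul_le (h : ListsPairs A L) (hA : 2 ≤ A.card) (q : ℕ) :
    (irregularList (q + 3) A.card L).length * 2 ^ (q * A.card.size) ≤ 2 ^ L.length := by
  set ℓ := A.card.size
  have hℓ : 1 ≤ ℓ := Nat.size_pos.2 (by omega)
  have hcard : (irregularList (q + 3) A.card L).length =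
      ((Finset.range (2 ^ L.length)).filter (Irregular (q + 3) A.card L ·)).card := by
    rw [irregularList, ← List.toFinset_card_of_nodup (List.nodup_range.filter _),
      List.toFinset_filter, List.toFinset_range]
    simp
  have hsub : (Finset.range (2 ^ L.length)).filter (Irregular (q + 3) A.card L ·) ⊆
      (A ×ˢ A).biUnion fun x => (Finset.range (2 ^ L.length)).filter fun m =>
        Deviates (q + 3) A.card L (selectBits L m) x.1 x.2 := by
    intro m hm
    obtain ⟨hm, hirr⟩ := Finset.mem_filter.1 hm
    obtain ⟨u, hu, v, hv, hd⟩ := (h.irregular_iff hA).1 hirr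
    exact Finset.mem_biUnion.2 ⟨(u, v), Finset.mk_mem_product hu hv, Finset.mem_filter.2 ⟨hm, hd⟩⟩
  have hle : ((irregularList (q + 3) A.card L).length : ℝ) ≤
      (A.card * A.card) * (2 * 2 ^ L.length * Real.exp (-((q + 3 : ℕ) * ℓ))) := by
    rw [hcard]
    refine (Nat.cast_le.2 ((Finset.card_le_card hsub).trans Finset.card_biUnion_le)).trans ?_
    rw [Nat.cast_sum]
    refine (Finset.sum_le_card_nsmul _ _ _ fun x hx => h.card_deviates_le
      (Finset.mem_product.1 hx).1 (Finset.mem_product.1 hx).2 (q + 3)).trans_eq ?_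
    rw [nsmul_eq_mul, Finset.card_product, Nat.cast_mul]
  have hN : (A.card : ℝ) ≤ 2 ^ ℓ := by
    exact_mod_cast (Nat.lt_size_self A.card).le
  have he : Real.exp (-((q + 3 : ℕ) * ℓ)) * 2 ^ ((q + 3) * ℓ) ≤ 1 := by
    have h2 : (2 : ℝ) ^ ((q + 3) * ℓ) ≤ Real.exp ((q + 3 : ℕ) * ℓ) := by
      rw [← Nat.cast_mul, ← Real.exp_one_pow]
      exact pow_le_pow_left₀ (by norm_num) (by linarith [Real.add_one_le_exp (1 : ℝ)]) _
    calc _ ≤ Real.exp (-((q + 3 : ℕ) * ℓ)) * Real.exp ((q + 3 : ℕ) * ℓ) := by gcongr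
      _ = 1 := by rw [← Real.exp_add]; simp
  have h2ℓ : (2 : ℝ) ≤ 2 ^ ℓ := by
    simpa using pow_le_pow_right₀ (one_le_two (α := ℝ)) hℓ
  have hfin : ((irregularList (q + 3) A.card L).length : ℝ) * 2 ^ (q * ℓ) ≤ 2 ^ L.length := by
    calc _ ≤ ((2 ^ ℓ * 2 ^ ℓ) * (2 ^ ℓ * 2 ^ L.length * Real.exp (-((q + 3 : ℕ) * ℓ))))
          * 2 ^ (q * ℓ) := by
          refine mul_le_mul_of_nonneg_right (hle.trans ?_) (by positivity)
          gcongr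
      _ = 2 ^ L.length * (Real.exp (-((q + 3 : ℕ) * ℓ)) * 2 ^ ((q + 3) * ℓ)) := by ring
      _ ≤ 2 ^ L.length := mul_le_of_le_one_right (by positivity) he
  exact_mod_cast hfin

end ListsPairs

end PairListing

/-! ### Random members of recursively labeled families are regular -/

namespace SimpleTVG

theorem mem_possibleEdges (G : SimpleTVG) {a b : CompositeVertex} :
    s(a, b) ∈ G.possibleEdges ↔
      a ∈ G.compositeVertices ∧ b ∈ G.compositeVertices ∧ a ≠ b := by
  simp only [possibleEdges, Finset.mem_image, Finset.mem_offDiag, Sym2.eq_iff]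
  constructor
  · rintro ⟨⟨c, d⟩, ⟨hc, hd, hne⟩, ⟨rfl, rfl⟩ | ⟨rfl, rfl⟩⟩
    exacts [⟨hc, hd, hne⟩, ⟨hd, hc, hne.symm⟩]
  · exact fun h => ⟨(a, b), h, Or.inl ⟨rfl, rfl⟩⟩

/-- The first possible composite edges in the order of `f`. -/
def edgeList (G : SimpleTVG) (f : ℕ → CompositeVertex × CompositeVertex) :
    List (CompositeVertex × CompositeVertex) :=
  (List.range (G.order * (G.order - 1) / 2)).map f

theorem length_edgeList (G : SimpleTVG) (f : ℕ → CompositeVertex × CompositeVertex) :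
    (G.edgeList f).length = G.order.choose 2 := by
  rw [edgeList, List.length_map, List.length_range, Nat.choose_two_right]

theorem edgeList_eq (G : SimpleTVG) (f : ℕ → CompositeVertex × CompositeVertex) :
    G.edgeList f = (List.range G.possibleEdges.card).map f := by
  rw [edgeList, card_possibleEdges, Nat.choose_two_right]

/-- The composite edge set as a bit vector. -/
def edgeBits (G : SimpleTVG) (f : ℕ → CompositeVertex × CompositeVertex) : ℕ :=
  Nat.ofBits fun j : Fin G.possibleEdges.card => decide (s((f j).1, (f j).2) ∈ G.E)

theorem testBit_edgeBits (G : SimpleTVG) (f : ℕ → CompositeVertex × CompositeVertex) {j : ℕ}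
    (hj : j < G.possibleEdges.card) :
    (G.edgeBits f).testBit j = decide (s((f j).1, (f j).2) ∈ G.E) :=
  Nat.testBit_ofBits_lt _ j hj

theorem edgeBits_lt (G : SimpleTVG) (f : ℕ → CompositeVertex × CompositeVertex) :
    G.edgeBits f < 2 ^ (G.edgeList f).length := by
  rw [length_edgeList, ← card_possibleEdges]
  exact Nat.ofBits_lt_two_pow _

variable {G : SimpleTVG} {e f : ℕ → CompositeVertex × CompositeVertex}

theorem edgeString_eq (hf : ∀ i < G.possibleEdges.card, f i = e (i + 1)) :
    G.edgeString e = binaryCode (tagBits (G.edgeList f) (G.edgeBits f)) := by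
  rw [edgeString, edgeList_eq, tagBits_map_range]
  congr 1
  refine List.map_congr_left fun i hi => ?_
  have hi := List.mem_range.1 hi
  rw [testBit_edgeBits _ _ hi, hf i hi]

theorem listsPairs_edgeList
    (he : Set.BijOn (fun j => s((e j).1, (e j).2)) (Set.Icc 1 G.possibleEdges.card)
      (G.possibleEdges : Set (Sym2 CompositeVertex)))
    (hf : ∀ i < G.possibleEdges.card, f i = e (i + 1)) :
    ListsPairs G.compositeVertices (G.edgeList f) := by
  rw [edgeList_eq]
  constructor
  · rw [List.map_map]
    refine List.Nodup.map_on (fun i hi j hj hij => ?_) List.nodup_range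
    have hi := List.mem_range.1 hi
    have hj := List.mem_range.1 hj
    simp only [Function.comp, hf i hi, hf j hj] at hij
    have := he.injOn (show i + 1 ∈ _ from ⟨by omega, hi⟩) (show j + 1 ∈ _ from ⟨by omega, hj⟩) hij
    omega
  · intro a b
    rw [← mem_possibleEdges, ← Finset.mem_coe, ← he.image_eq, List.map_map]
    simp only [List.mem_map, List.mem_range, Set.mem_image, Set.mem_Icc, Function.comp]
    constructor
    · rintro ⟨i, hi, h⟩
      rw [hf i hi] at h
      exact ⟨i + 1, ⟨by omega, hi⟩, h⟩
    · rintro ⟨j, ⟨h1, h2⟩, h⟩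
      refine ⟨j - 1, by omega, ?_⟩
      rw [hf _ (by omega), Nat.sub_add_cancel h1, h]

/-- The digits of `edgeBits` select exactly the edges of `G`, so statements on selected lists become
statements on `G.E`. -/
theorem mem_neighborList_edgeBits (hL : ListsPairs G.compositeVertices (G.edgeList f))
    {a b : CompositeVertex} (ha : a ∈ G.compositeVertices) (hb : b ∈ G.compositeVertices)
    (hab : a ≠ b) :
    b ∈ neighborList (selectBits (G.edgeList f) (G.edgeBits f)) a ↔ s(a, b) ∈ G.E := by
  have hlt := hL.pairIndex_lt ha hb hab
  have hlt' := List.idxOf_lt_length_iff.2 ((hL.mem_iff a b).2 ⟨ha, hb, hab⟩)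
  have hget := List.getElem_idxOf hlt'
  rw [length_edgeList, ← card_possibleEdges] at hlt
  rw [hL.mem_neighborList_selectBits ha hb hab, testBit_edgeBits _ _ hlt, decide_eq_true_eq]
  rw [List.getElem_map] at hget
  simp only [edgeList_eq, List.getElem_map, List.getElem_range] at hget
  rw [pairIndex, edgeList_eq, hget]

end SimpleTVG

theorem logb_two_le_size (N : ℕ) (hN : 1 ≤ N) : Real.logb 2 N ≤ N.size := by
  rw [Real.logb_le_iff_le_rpow one_lt_two (by exact_mod_cast hN), Real.rpow_natCast]
  exact_mod_cast (Nat.lt_size_self N).le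

theorem size_le_two_mul_logb (N : ℕ) (hN : 2 ≤ N) : (N.size : ℝ) ≤ 2 * Real.logb 2 N := by
  have hN' : (0 : ℝ) < N := by exact_mod_cast (by omega : 0 < N)
  have h1 : 1 ≤ Real.logb 2 N := by
    rw [Real.le_logb_iff_rpow_le one_lt_two hN', Real.rpow_one]
    exact_mod_cast hN
  have hs : 0 < N.size := Nat.size_pos.2 (by omega)
  have h2 : ((N.size - 1 : ℕ) : ℝ) ≤ Real.logb 2 N := by
    rw [Real.le_logb_iff_rpow_le one_lt_two hN', Real.rpow_natCast]
    exact_mod_cast Nat.lt_size.1 (Nat.sub_lt hs one_pos)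
  rw [Nat.cast_sub hs, Nat.cast_one] at h2
  linarith

/-- In a recursively labeled family of random graphs, a large member has no deviations. -/
theorem exists_forall_not_deviates {U : Machine} (hU : IsUniversal U) {F : Set SimpleTVG}
    {e : ℕ → CompositeVertex × CompositeVertex} (hlab : IsRecursivelyLabeled U F e)
    {δ : ℕ → ℕ} (hδ : (fun n => (δ n : ℝ)) =O[atTop] fun n : ℕ => Real.logb 2 n)
    (hrand : ∀ G ∈ F, G.IsCRandom U e δ) :
    ∃ (κ n₀ : ℕ) (f : ℕ → CompositeVertex × CompositeVertex), ∀ G ∈ F, n₀ ≤ G.order →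
      ListsPairs G.compositeVertices (G.edgeList f) ∧
      ∀ u ∈ G.compositeVertices, ∀ v ∈ G.compositeVertices,
        ¬ Deviates κ G.order (G.edgeList f) (selectBits (G.edgeList f) (G.edgeBits f)) u v := by
  obtain ⟨f, hfc, hf⟩ := hlab.exists_computable hU
  obtain ⟨C, hC⟩ := hδ.bound
  obtain ⟨n₁, hn₁⟩ := eventually_atTop.1 hC
  -- `⌈C⌉₊ * ℓ` of the saving `q * ℓ` absorbs `δ`. The remaining `ℓ` beats the machine constant `c`,
  -- because an order of at least `2 ^ c` forces `c < ℓ`.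
  set q := ⌈C⌉₊ + 1 with hq
  obtain ⟨c, hc⟩ := hU.exists_plainComplexity_le (computable₂_irregularString (q + 3) hfc)
  refine ⟨q + 3, max (max 2 n₁) (2 ^ c), f, fun G hG hN => ?_⟩
  have h2 : 2 ≤ G.order := (le_max_left _ _).trans ((le_max_left _ _).trans hN)
  have hL := SimpleTVG.listsPairs_edgeList (hlab.1 G hG) (hf G hG)
  refine ⟨hL, fun u hu v hv hdev => ?_⟩
  have hirr : Irregular (q + 3) G.order (G.edgeList f) (G.edgeBits f) :=
    (hL.irregular_iff h2).2 ⟨u, hu, v, hv, hdev⟩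
  have hmem : G.edgeBits f ∈ irregularList (q + 3) G.order (G.edgeList f) :=
    List.mem_filter.2 ⟨List.mem_range.2 (G.edgeBits_lt f), by simpa using hirr⟩
  obtain ⟨i, hi, hget⟩ := List.mem_iff_getElem.1 hmem
  have hstr : irregularString (q + 3) f G.order i = G.edgeString e := by
    rw [SimpleTVG.edgeString_eq (hf G hG), irregularString]
    change binaryCode (tagBits (G.edgeList f)
      ((irregularList (q + 3) G.order (G.edgeList f)).getD i 0)) = _
    rw [List.getD_eq_getElem _ _ hi, hget]
  have hcount := hL.length_irregularList_mul_le h2 q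
  rw [G.length_edgeList] at hcount
  change _ * 2 ^ (q * G.order.size) ≤ _ at hcount
  have hle : (i + 1) * 2 ^ (q * G.order.size) ≤ 2 ^ G.order.choose 2 :=
    (Nat.mul_le_mul_right _ hi).trans hcount
  -- The list is nonempty, so the subtraction in the bound on `i.size` does not truncate.
  have hqn : q * G.order.size ≤ G.order.choose 2 :=
    (Nat.pow_le_pow_iff_right one_lt_two).1
      ((Nat.le_mul_of_pos_left _ i.succ_pos).trans hle)
  have hsize : i.size ≤ G.order.choose 2 - q * G.order.size := by
    rw [Nat.size_le]
    have : (i + 1) * 2 ^ (q * G.order.size) ≤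
        2 ^ (G.order.choose 2 - q * G.order.size) * 2 ^ (q * G.order.size) := by
      rwa [← pow_add, Nat.sub_add_cancel hqn]
    exact Nat.le_of_mul_le_mul_right this (by positivity)
  have hcomp := hc G.order i
  rw [hstr] at hcomp
  have hr := hrand G hG
  rw [SimpleTVG.IsCRandom] at hr
  have hupper : (plainComplexity U (G.edgeString e) (binaryCode G.order) : ℝ) +
      q * G.order.size ≤ G.order.choose 2 + c := by
    exact_mod_cast (by omega : plainComplexity U (G.edgeString e) (binaryCode G.order) +
      q * G.order.size ≤ G.order.choose 2 + c)
  have hlog := logb_two_le_size G.order (by omega)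
  have hδN := hn₁ G.order ((le_max_right _ _).trans ((le_max_left _ _).trans hN))
  have hlog0 : 0 ≤ Real.logb 2 G.order :=
    Real.logb_nonneg one_lt_two (by exact_mod_cast (by omega : 1 ≤ G.order))
  rw [Real.norm_natCast, Real.norm_of_nonneg hlog0] at hδN
  have hδN' : (δ G.order : ℝ) ≤ ⌈C⌉₊ * G.order.size :=
    hδN.trans (mul_le_mul (Nat.le_ceil C) hlog hlog0 (Nat.cast_nonneg _))
  have hcs : (c : ℝ) < G.order.size := by
    exact_mod_cast Nat.lt_size.2 ((le_max_right _ _).trans hN)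
  have hqs : (q : ℝ) * G.order.size = ⌈C⌉₊ * G.order.size + G.order.size := by
    rw [hq]; push_cast; ring
  linarith

/-! ### Graphs without deviations -/

/-- A path of length 2 is determined by its midpoint, a common neighbour of the ends. Conversely,
disjoint paths have different midpoints, as a midpoint is neither `u` nor `v`. -/
theorem isMaxDisjointPaths_two {W : Type*} [Finite W] (H : SimpleGraph W) {u v : W} (huv : u ≠ v) :
    IsMaxDisjointPaths H u v 2 (H.commonNeighbors u v).ncard := by
  classical
  have := Fintype.ofFinite W
  constructor
  · let g : H.commonNeighbors u v → H.Walk u v := fun w =>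
      .cons (show H.Adj u w from w.2.1) (.cons (show H.Adj v w from w.2.2).symm .nil)
    have hg : Function.Injective g := fun w w' h =>
      Subtype.ext (congrArg (fun p : H.Walk u v => p.getVert 1) h)
    refine ⟨Finset.univ.image g, ?_, ?_, ?_⟩
    · rw [Finset.card_image_of_injective _ hg, Finset.card_univ, ← Nat.card_eq_fintype_card,
        Nat.card_coe_set_eq]
    · rintro p hp
      obtain ⟨⟨w, hu, hv⟩, -, rfl⟩ := Finset.mem_image.1 hp
      have hu : u ≠ w := SimpleGraph.Adj.ne hu
      have hv : w ≠ v := (SimpleGraph.Adj.ne hv).symm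
      exact ⟨by simp [g, SimpleGraph.Walk.isPath_def, hu, hv, huv], rfl⟩
    · rintro p hp q hq hne x hxp hxq
      obtain ⟨w, -, rfl⟩ := Finset.mem_image.1 hp
      obtain ⟨w', -, rfl⟩ := Finset.mem_image.1 hq
      have hww : (w : W) ≠ w' := fun h => hne (congrArg g (Subtype.ext h))
      simp only [g, SimpleGraph.Walk.support_cons, SimpleGraph.Walk.support_nil, List.mem_cons,
        List.not_mem_nil, or_false] at hxp hxq
      grind
  · rintro k ⟨S, rfl, hS, hdisj⟩
    have hadj : ∀ p ∈ S, H.Adj u (p.getVert 1) ∧ H.Adj v (p.getVert 1) := by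
      intro p hp
      obtain ⟨-, hl⟩ := hS p hp
      have h0 := p.adj_getVert_succ (i := 0) (by omega)
      have h1 := p.adj_getVert_succ (i := 1) (by omega)
      have h2 : p.getVert 2 = v := by rw [← hl, p.getVert_length]
      rw [p.getVert_zero] at h0
      rw [h2] at h1
      exact ⟨h0, h1.symm⟩
    rw [Set.ncard_eq_toFinset_card']
    refine Finset.card_le_card_of_injOn (fun p => p.getVert 1)
      (fun p hp => by simpa [SimpleGraph.mem_commonNeighbors] using hadj p hp) ?_
    intro p hp q hq hpq
    by_contra hne
    rcases hdisj p hp q hq hne _ (p.getVert_mem_support 1)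
      (by simp [hpq]) with h | h
    · exact (hadj p hp).1.ne h.symm
    · exact (hadj p hp).2.ne h.symm

theorem card_filter_add_card_filter {α : Type*} (W : Finset α) (p q : α → Prop)
    [DecidablePred p] [DecidablePred q] :
    (W.filter p).card + (W.filter q).card =
      (W.filter fun w => (p w ∧ ¬ q w) ∨ (q w ∧ ¬ p w)).card +
        2 * (W.filter fun w => p w ∧ q w).card := by
  simp only [Finset.card_filter, Finset.mul_sum, ← Finset.sum_add_distrib]
  refine Finset.sum_congr rfl fun w _ => ?_
  by_cases h1 : p w <;> by_cases h2 : q w <;> simp [h1, h2]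

/-- Compare squares: `log n = o(n)` gives `n log n = o(n ^ 2)`. -/
theorem isLittleO_sqrt_mul_logb :
    (fun n : ℕ => Real.sqrt (n * Real.logb 2 n)) =o[atTop] fun n : ℕ => (n : ℝ) := by
  refine IsLittleO.of_pow (n := 2) ?_ two_ne_zero
  have h : (fun n : ℕ => (n : ℝ) * Real.logb 2 n) =o[atTop] fun n : ℕ => (n : ℝ) * n := by
    refine (isBigO_refl _ _).mul_isLittleO ?_
    have := (Real.isLittleO_log_id_atTop.const_mul_left (Real.log 2)⁻¹).comp_tendsto
      tendsto_natCast_atTop_atTop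
    refine this.congr_left fun n => ?_
    simp [Real.logb, div_eq_inv_mul]
  refine h.congr' ?_ (Eventually.of_forall fun n => (sq (n : ℝ)).symm)
  filter_upwards [eventually_ge_atTop 1] with n hn
  have : 0 ≤ Real.logb 2 n := Real.logb_nonneg one_lt_two (by exact_mod_cast hn)
  exact (Real.sq_sqrt (by positivity)).symm

namespace SimpleTVG

variable (G : SimpleTVG)

theorem ncard_subtype (p : CompositeVertex → Prop) [DecidablePred p] :
    {w : {a // a ∈ G.compositeVertices} | p w}.ncard =
      (G.compositeVertices.filter p).card := by
  rw [← Set.ncard_image_of_injective _ Subtype.val_injective, ← Set.ncard_coe_finset]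
  congr 1
  ext w
  simp only [Set.mem_image, Set.mem_ofPred_eq, Subtype.exists, exists_and_left, exists_prop,
    exists_eq_right_right, Finset.coe_filter]
  tauto

theorem ediam_graph_eq_two (h2 : 2 ≤ G.order)
    (hcommon : ∀ u v, u ≠ v → (G.graph.commonNeighbors u v).Nonempty)
    (hdeg : ∃ u, (G.graph.neighborSet u).ncard + 1 < G.order) : G.graph.ediam = 2 := by
  have hnt : Nontrivial {a // a ∈ G.compositeVertices} := by
    rw [← Fintype.one_lt_card_iff_nontrivial, Fintype.card_coe]
    exact h2
  have hle : G.graph.ediam ≤ 2 := by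
    refine SimpleGraph.ediam_le_of_edist_le fun u v => ?_
    by_cases huv : u = v
    · simp [huv]
    · obtain ⟨w, hu, hv⟩ := hcommon u v huv
      exact SimpleGraph.Walk.edist_le 
        (.cons (show G.graph.Adj u w from hu) (.cons (show G.graph.Adj v w from hv).symm .nil))
  have h0 := SimpleGraph.ediam_ne_zero (G := G.graph)
  have h1 : G.graph.ediam ≠ 1 := by
    rw [Ne, SimpleGraph.ediam_eq_one]
    intro htop
    obtain ⟨u, hu⟩ := hdeg
    have : (G.graph.neighborSet u).ncard + 1 = G.order := by
      rw [htop, SimpleGraph.neighborSet_top, Set.ncard_compl, Set.ncard_singleton, Nat.card_eq_fintype_card,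
        Fintype.card_coe]
      exact Nat.sub_add_cancel (one_le_two.trans h2)
    omega
  have htop : G.graph.ediam ≠ ⊤ := ne_top_of_le_ne_top (by simp) hle
  generalize G.graph.ediam = d at *
  lift d to ℕ using htop
  norm_cast at *
  omega

end SimpleTVG

/-- Estimates for degrees and for numbers of common neighbours, given that the numbers of separated
vertices are close to their means. -/
theorem card_filter_estimates {α : Type*} [DecidableEq α] (A : Finset α) (R : α → α → Prop)
    [∀ a b, Decidable (R a b)] (hR : ∀ a, ¬ R a a) {T : ℝ} {u v : α}
    (hdu : |((A.filter (R u)).card : ℝ) - ((A.card : ℝ) - 1) / 2| ≤ T / 2)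
    (hdv : |((A.filter (R v)).card : ℝ) - ((A.card : ℝ) - 1) / 2| ≤ T / 2)
    (hX : |2 * ((((A.erase u).erase v).filter
      fun w => (R u w ∧ ¬ R v w) ∨ (R v w ∧ ¬ R u w)).card : ℝ) - ((A.card : ℝ) - 2)| ≤ T) :
    |((A.filter fun w => R u w ∧ R v w).card : ℝ) - (A.card : ℝ) / 4| ≤ 3 / 4 * T + 2 := by
  set W := (A.erase u).erase v with hW
  have hsub : W ⊆ A := (Finset.erase_subset _ _).trans (Finset.erase_subset _ _)
  -- `W` lacks only `u` and `v`, and `p` fails at one of them, so at most one element is lost. For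
  -- `p = R u` this is irreflexivity.
  have hlow : ∀ p : α → Prop, [DecidablePred p] → (¬ p u ∨ ¬ p v) →
      (A.filter p).card ≤ (W.filter p).card + 1 := by
    intro p _ hp
    obtain ⟨x, hx⟩ : ∃ x, A.filter p ⊆ insert x (W.filter p) := by
      rcases hp with hp | hp
      · refine ⟨v, fun w hw => ?_⟩
        simp only [hW, Finset.mem_insert, Finset.mem_filter, Finset.mem_erase] at hw ⊢
        grind
      · refine ⟨u, fun w hw => ?_⟩
        simp only [hW, Finset.mem_insert, Finset.mem_filter, Finset.mem_erase] at hw ⊢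
        grind
    exact (Finset.card_le_card hx).trans (Finset.card_insert_le _ _)
  have hup : ∀ p : α → Prop, [DecidablePred p] → (W.filter p).card ≤ (A.filter p).card :=
    fun p _ => Finset.card_le_card (Finset.filter_subset_filter p hsub)
  have hK : (A.filter fun w => R u w ∧ R v w) = W.filter fun w => R u w ∧ R v w := by
    ext w
    simp only [hW, Finset.mem_filter, Finset.mem_erase]
    grind
  have h := card_filter_add_card_filter W (R u) (R v)
  have h1 := hlow (R u) (Or.inl (hR u))
  have h2 := hlow (R v) (Or.inr (hR v))
  have h3 := hup (R u)
  have h4 := hup (R v)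
  rw [hK]
  rify at h h1 h2 h3 h4
  rw [abs_le] at *
  constructor <;> linarith

namespace SimpleTVG

variable (G : SimpleTVG) {f : ℕ → CompositeVertex × CompositeVertex}

theorem not_mem_E_self (a : CompositeVertex) : s(a, a) ∉ G.E := fun h =>
  (G.mem_possibleEdges.1 (G.E_subset h)).2.2 rfl

theorem separates_iff (hL : ListsPairs G.compositeVertices (G.edgeList f))
    {u v w : CompositeVertex} (hu : u ∈ G.compositeVertices) (hv : v ∈ G.compositeVertices)
    (hw : w ∈ (G.compositeVertices.erase u).erase v) :
    Separates (selectBits (G.edgeList f) (G.edgeBits f)) u v w ↔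
      (s(u, w) ∈ G.E ∧ ¬ (u ≠ v ∧ s(v, w) ∈ G.E)) ∨
        ((u ≠ v ∧ s(v, w) ∈ G.E) ∧ s(u, w) ∉ G.E) := by
  simp only [Finset.mem_erase] at hw
  rw [Separates, mem_neighborList_edgeBits hL hu hw.2.2 (Ne.symm hw.2.1),
    mem_neighborList_edgeBits hL hv hw.2.2 (Ne.symm hw.1)]

theorem abs_le_of_not_deviates (hL : ListsPairs G.compositeVertices (G.edgeList f)) {κ : ℕ}
    {u v : CompositeVertex} (hu : u ∈ G.compositeVertices) (hv : v ∈ G.compositeVertices)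
    (hd : ¬ Deviates κ G.order (G.edgeList f) (selectBits (G.edgeList f) (G.edgeBits f)) u v) :
    |2 * ((((G.compositeVertices.erase u).erase v).filter fun w =>
        (s(u, w) ∈ G.E ∧ ¬ (u ≠ v ∧ s(v, w) ∈ G.E)) ∨
          ((u ≠ v ∧ s(v, w) ∈ G.E) ∧ s(u, w) ∉ G.E)).card : ℝ) -
      (((G.compositeVertices.erase u).erase v).card : ℝ)| ≤
      Real.sqrt (2 * κ * G.order * G.order.size) := by
  rw [hL.deviates_iff hu, not_le,
    Finset.filter_congr fun w hw => G.separates_iff hL hu hv hw] at hd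
  exact Real.abs_le_sqrt hd.le

/-- On the diagonal `u = v`, separation is adjacency to `u`, and erasing `u` loses no neighbour
because there are no loops. -/
theorem abs_degree_le (hL : ListsPairs G.compositeVertices (G.edgeList f)) {κ : ℕ}
    {u : CompositeVertex} (hu : u ∈ G.compositeVertices)
    (hd : ¬ Deviates κ G.order (G.edgeList f) (selectBits (G.edgeList f) (G.edgeBits f)) u u) :
    |((G.compositeVertices.filter fun w => s(u, w) ∈ G.E).card : ℝ) - ((G.order : ℝ) - 1) / 2| ≤
      Real.sqrt (2 * κ * G.order * G.order.size) / 2 := by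
  have h := G.abs_le_of_not_deviates hL hu hu hd
  have hc : ((G.compositeVertices.erase u).card : ℝ) = G.order - 1 := by
    rw [Finset.card_erase_of_mem hu, Nat.cast_sub (Finset.card_pos.2 ⟨u, hu⟩), Nat.cast_one]
    rfl
  have hset : ((G.compositeVertices.erase u).filter fun w => s(u, w) ∈ G.E) =
      G.compositeVertices.filter fun w => s(u, w) ∈ G.E := by
    ext w
    simp only [Finset.mem_filter, Finset.mem_erase]
    refine ⟨fun h => ⟨h.1.2, h.2⟩, fun h => ⟨⟨?_, h.1⟩, h.2⟩⟩
    rintro rfl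
    exact G.not_mem_E_self w h.2
  simp only [Finset.erase_idem, ne_eq, not_true_eq_false, false_and, not_false_eq_true, and_true,
    or_false, hset, hc] at h
  rw [abs_le] at *
  constructor <;> linarith

theorem abs_common_le (hL : ListsPairs G.compositeVertices (G.edgeList f)) {κ : ℕ}
    {u v : CompositeVertex} (hu : u ∈ G.compositeVertices) (hv : v ∈ G.compositeVertices)
    (huv : u ≠ v)
    (hd : ∀ a ∈ G.compositeVertices, ∀ b ∈ G.compositeVertices,
      ¬ Deviates κ G.order (G.edgeList f) (selectBits (G.edgeList f) (G.edgeBits f)) a b) :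
    |((G.compositeVertices.filter fun w => s(u, w) ∈ G.E ∧ s(v, w) ∈ G.E).card : ℝ) -
      (G.order : ℝ) / 4| ≤ 3 / 4 * Real.sqrt (2 * κ * G.order * G.order.size) + 2 := by
  have h := G.abs_le_of_not_deviates hL hu hv (hd u hu v hv)
  have hc : (((G.compositeVertices.erase u).erase v).card : ℝ) = G.order - 2 := by
    rw [Finset.card_erase_of_mem (Finset.mem_erase.2 ⟨huv.symm, hv⟩), Finset.card_erase_of_mem hu,
      Nat.sub_sub, Nat.cast_sub (Finset.one_lt_card.2 ⟨u, hu, v, hv, huv⟩)]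
    norm_num
    rfl
  simp only [huv, ne_eq, not_false_eq_true, true_and, hc] at h
  exact card_filter_estimates G.compositeVertices (fun a b => s(a, b) ∈ G.E) G.not_mem_E_self
    (G.abs_degree_le hL hu (hd u hu u hu)) (G.abs_degree_le hL hv (hd v hv v hv)) h

end SimpleTVG

theorem corollary5p1 (U : Machine) (hU : IsUniversal U)
    (F : Set SimpleTVG) (hF : F.Infinite)
    (e : ℕ → CompositeVertex × CompositeVertex) (hlab : IsRecursivelyLabeled U F e)
    (δ : ℕ → ℕ) (hδ : (fun n => (δ n : ℝ)) =O[atTop] fun n : ℕ => Real.logb 2 n)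
    (hrand : ∀ G ∈ F, G.IsCRandom U e δ) :
    ∃ (c : ℝ) (ε : ℕ → ℝ) (n₀ : ℕ), (ε =o[atTop] fun n : ℕ => (n : ℝ)) ∧
      ∀ G ∈ F, n₀ ≤ G.order →
        (∀ v, |((G.graph.neighborSet v).ncard : ℝ) - ((G.order : ℝ) - 1) / 2|
          ≤ c * Real.sqrt ((G.order : ℝ) * Real.logb 2 G.order)) ∧
        (∀ u v, u ≠ v → ∃ m : ℕ, IsMaxDisjointPaths G.graph u v 2 m ∧
          |(m : ℝ) - (G.order : ℝ) / 4| ≤ ε G.order) ∧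
        G.graph.ediam = 2 := by
  obtain ⟨κ, n₀, f, hreg⟩ := exists_forall_not_deviates hU hlab hδ hrand
  set c : ℝ := Real.sqrt κ with hc
  set S : ℕ → ℝ := fun n => Real.sqrt (n * Real.logb 2 n) with hS
  have hε : (fun n => 3 / 2 * c * S n + 2) =o[atTop] fun n : ℕ => (n : ℝ) :=
    (isLittleO_sqrt_mul_logb.const_mul_left _).add
      ((isLittleO_const_id_atTop (2 : ℝ)).comp_tendsto tendsto_natCast_atTop_atTop)
  -- An error of at most `N / 8` serves twice in the diameter argument: it keeps the common
  -- neighbours, about `N / 4`, positive in number, and the degrees, about `N / 2`, below `N - 1`.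
  obtain ⟨n₁, hn₁⟩ := eventually_atTop.1 (hε.bound (by norm_num : (0 : ℝ) < 1 / 8))
  refine ⟨c, fun n => 3 / 2 * c * S n + 2, max (max 2 n₀) n₁, hε, fun G hG hN => ?_⟩
  have h2 : 2 ≤ G.order := (le_max_left _ _).trans ((le_max_left _ _).trans hN)
  have hN0 : (2 : ℝ) ≤ G.order := by exact_mod_cast h2
  obtain ⟨hL, hdev⟩ := hreg G hG ((le_max_right _ _).trans ((le_max_left _ _).trans hN))
  have hsmall := (le_abs_self _).trans (hn₁ G.order ((le_max_right _ _).trans hN))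
  rw [Real.norm_natCast] at hsmall
  -- `N.size ≤ 2 * logb 2 N` bounds the radicand by `4 * κ * N * logb 2 N`, hence `c = √κ`.
  have hT : Real.sqrt (2 * κ * G.order * G.order.size) ≤ 2 * (c * S G.order) := by
    have hlog := size_le_two_mul_logb G.order h2
    have : 2 * (c * S G.order) = Real.sqrt (4 * (κ * (G.order * Real.logb 2 G.order))) := by
      rw [Real.sqrt_mul (by norm_num), Real.sqrt_mul (by positivity),
        show (4 : ℝ) = 2 ^ 2 by norm_num, Real.sqrt_sq (by norm_num)]
    rw [this]
    refine Real.sqrt_le_sqrt ?_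
    calc (2 * κ * G.order * G.order.size : ℝ) ≤ 2 * κ * G.order * (2 * Real.logb 2 G.order) := by
          gcongr
      _ = _ := by ring
  have hcS : 0 ≤ c * S G.order := mul_nonneg (Real.sqrt_nonneg _) (Real.sqrt_nonneg _)
  have hdeg : ∀ v, |((G.graph.neighborSet v).ncard : ℝ) - ((G.order : ℝ) - 1) / 2| ≤
      c * S G.order := by
    intro v
    have : (G.graph.neighborSet v).ncard = _ :=
      G.ncard_subtype fun w => s(v.1, w) ∈ G.E
    rw [this]
    exact (G.abs_degree_le hL v.2 (hdev v v.2 v v.2)).trans (by linarith)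
  have hcommon : ∀ u v, u ≠ v →
      |((G.graph.commonNeighbors u v).ncard : ℝ) - (G.order : ℝ) / 4| ≤
        3 / 2 * c * S G.order + 2 := by
    intro u v huv
    have : (G.graph.commonNeighbors u v).ncard = _ :=
      G.ncard_subtype fun w => s(u.1, w) ∈ G.E ∧ s(v.1, w) ∈ G.E
    rw [this]
    exact (G.abs_common_le hL u.2 v.2 (Subtype.coe_ne_coe.2 huv) hdev).trans (by linarith)
  refine ⟨hdeg, fun u v huv => ⟨_, isMaxDisjointPaths_two G.graph huv, hcommon u v huv⟩,
    G.ediam_graph_eq_two h2 (fun u v huv => ?_) ?_⟩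
  · refine (Set.ncard_pos).1 ?_
    have := (abs_le.1 (hcommon u v huv)).1
    have hpos : (0 : ℝ) < (G.graph.commonNeighbors u v).ncard := by linarith
    exact_mod_cast hpos
  · obtain ⟨u, hu⟩ := Finset.card_pos.1 (lt_of_lt_of_le two_pos h2)
    refine ⟨⟨u, hu⟩, ?_⟩
    have := (abs_le.1 (hdeg ⟨u, hu⟩)).2
    have hlt : ((G.graph.neighborSet ⟨u, hu⟩).ncard : ℝ) + 1 < G.order := by linarith
    exact_mod_cast hlt
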